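/- Let $k\ge 1$, let $\Omega=\{1,\dots,k\}^{\mathbb N}$ carry the distance $d(x,y)=2^{-\min\{n:\,x_n\ne y_n\}}$ for $x\neq y$ (and $d(x,x)=0$), and let $\sigma:\Omega\to\Omega$, $(\sigma x)_n=x_{n+1}$, be the shift. Write $\mathcal M_\sigma$ for the set of $\sigma$-invariant Borel probability measures on $\Omega$ and $h_\mu$ for the Kolmogorov–Sinai entropy of $\mu\in\mathcal M_\sigma$. Let $A:\Omega\to\mathbb R$ be Hölder continuous with exponent $\alpha\in(0,1]$ (for $\alpha=1$: Lipschitz). Put $$m(A)=\max_{\nu\in\mathcal M_\sigma}\int A\,d\nu,\qquad \mathcal M_{\max}=\Big\{\mu\in\mathcal M_\sigma:\ \int A\,d\mu=m(A)\Big\},\qquad P(\beta)=\sup_{\mu\in\mathcal M_\sigma}\Big\{h_\mu+\beta\int A\,d\mu\Big\}.$$ An equilibrium state for $\beta A$ is a measure $\mu_\beta\in\mathcal M_\sigma$ with $h_{\mu_\beta}+\beta\int A\,d\mu_\beta=P(\beta)$. A ground state of $A$ is a weak-$*$ accumulation point, as $\beta\to+\infty$, of a family $(\mu_\beta)_{\beta>0}$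 in which every $\mu_\beta$ is an equilibrium state for $\beta A$. Then $h_{\max}:=\max\{h_\nu:\ \nu\in\mathcal M_{\max}\}$ exists and is finite; every ground state $\mu_\infty$ of $A$ belongs to $\mathcal M_{\max}$ and satisfies $h_{\mu_\infty}=h_{\max}$; and the pressure has the asymptote $h_{\max}+\beta\, m(A)$, that is, $$\lim_{\beta\to+\infty}\big(P(\beta)-h_{\max}-\beta\, m(A)\big)=0 .$$ -/

import Mathlib

open MeasureTheory Filter Topology

noncomputable section

namespace ErgOpt

/-- The one-sided full shift space on `k` symbols, with its product topology and Borel sets. -/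
abbrev FullShift (k : ℕ) : Type := ℕ → Fin k

variable {k : ℕ}

/-- The shift map `x₀x₁x₂… ↦ x₁x₂x₃…`. -/
def shift (x : FullShift k) : FullShift k := fun n => x (n + 1)

/-- The distance `2 ^ (-min {n | x n ≠ y n})` (and `0` if `x = y`). -/
def seqDist (x y : FullShift k) : ℝ := (PiNat.dist (E := fun _ : ℕ => Fin k)).dist x y

/-- `A` is Hölder continuous with exponent `α` (Lipschitz when `α = 1`). -/
def IsHolder (α : ℝ) (A : FullShift k → ℝ) : Prop :=
  ∃ C : ℝ, ∀ x y, |A x - A y| ≤ C * seqDist x y ^ α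

/-- Shift-invariance of a Borel probability measure. -/
def IsInvariant (μ : ProbabilityMeasure (FullShift k)) : Prop :=
  MeasurePreserving (shift (k := k)) (μ : Measure (FullShift k)) (μ : Measure (FullShift k))

/-- Shannon entropy of the finite partition into the level sets of `g`. -/
def partitionEntropy {ι : Type} [Fintype ι] (μ : ProbabilityMeasure (FullShift k))
    (g : FullShift k → ι) : ℝ :=
  ∑ a : ι, Real.negMulLog ((μ : Measure (FullShift k)).real (g ⁻¹' {a}))

/-- The map whose level sets form the join of the `shift^{-i}`-preimages, `0 ≤ i < n`, of the
partition into the level sets of `f`. -/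
def itinerary {m : ℕ} (f : FullShift k → Fin m) (n : ℕ) (x : FullShift k) : Fin n → Fin m :=
  fun i => f (shift^[i] x)

/-- Entropy of the shift with respect to the partition into the level sets of `f`. For invariant
`μ` the upper limit is a limit, by subadditivity. -/
def entropyOf {m : ℕ} (μ : ProbabilityMeasure (FullShift k)) (f : FullShift k → Fin m) : EReal :=
  limsup (fun n : ℕ => ((partitionEntropy μ (itinerary f n) / (n : ℝ) : ℝ) : EReal)) atTop

/-- Kolmogorov–Sinai entropy: the supremum over all finite measurable partitions. -/
def entropy (μ : ProbabilityMeasure (FullShift k)) : EReal :=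
  ⨆ (m : ℕ) (f : FullShift k → Fin m) (_ : Measurable f), entropyOf μ f

/-- The pressure of a potential `φ`. -/
def pressure (φ : FullShift k → ℝ) : EReal :=
  ⨆ (μ : ProbabilityMeasure (FullShift k)) (_ : IsInvariant μ),
    entropy μ + ((∫ x, φ x ∂(μ : Measure (FullShift k)) : ℝ) : EReal)

/-- Equilibrium states: invariant probabilities that realize the supremum in the pressure. -/
def IsEquilibriumState (φ : FullShift k → ℝ) (μ : ProbabilityMeasure (FullShift k)) : Prop :=
  IsInvariant μ ∧
    entropy μ + ((∫ x, φ x ∂(μ : Measure (FullShift k)) : ℝ) : EReal) = pressure φ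

/-- The integrals of `A` against the invariant probabilities. -/
def invariantIntegrals (A : FullShift k → ℝ) : Set ℝ :=
  {t | ∃ ν : ProbabilityMeasure (FullShift k), IsInvariant ν ∧
    t = ∫ x, A x ∂(ν : Measure (FullShift k))}

/-- The maximal integral `m(A)` over invariant probabilities. -/
def maxIntegral (A : FullShift k → ℝ) : ℝ := sSup (invariantIntegrals A)

/-- `A`-maximizing measures. -/
def IsMaximizing (A : FullShift k → ℝ) (μ : ProbabilityMeasure (FullShift k)) : Prop :=
  IsInvariant μ ∧ IsGreatest (invariantIntegrals A) (∫ x, A x ∂(μ : Measure (FullShift k)))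

/-- Ground states: weak-* accumulation points, as `β → +∞`, of equilibrium states `μ_β` for `β A`.
The topology on `ProbabilityMeasure` is that of weak convergence. -/
def IsGroundState (A : FullShift k → ℝ) (μ : ProbabilityMeasure (FullShift k)) : Prop :=
  ∃ μβ : ℝ → ProbabilityMeasure (FullShift k),
    (∀ β : ℝ, 0 < β → IsEquilibriumState (fun x => β * A x) (μβ β)) ∧ MapClusterPt μ atTop μβ

end ErgOpt

end

namespace ErgOpt

variable {k : ℕ}

/-! ### Shannon entropy of finite partitions -/

/-! The proof is a compactness argument on the weak-* compact set of invariant measures. The two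
facts that carry it are that `∫ A dμ` is weak-* continuous in `μ` and that entropy is upper
semicontinuous and bounded.

Semicontinuity comes from the generator theorem `entropy_eq_entropyRate`: the partition by the first
symbol carries all the entropy. Its itineraries have clopen level sets, and subadditivity turns the
limit into an infimum, so entropy is an infimum of continuous functions
(`upperSemicontinuous_entropyRate`).

Hence some maximizing measure `ν` has the largest entropy. As a competitor in the pressure, `ν`
gives `P(β) ≥ h(ν) + β m(A)`. Conversely, for large `β` a measure whose integral stays below `m(A)`
by a fixed amount loses more than bounded entropy can repay, while one with integral near `m(A)` has
entropy below `h(ν) + ε` (`exists_forall_entropyRate_lt`). Comparing an equilibrium state with `ν`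
and passing to cluster points settles the ground states. -/

lemma negMulLog_sum_le {ι : Type*} (s : Finset ι) (p : ι → ℝ) (hp : ∀ i, 0 ≤ p i) :
    Real.negMulLog (∑ i ∈ s, p i) ≤ ∑ i ∈ s, Real.negMulLog (p i) := by
  simp only [Real.negMulLog, neg_mul, Finset.sum_neg_distrib, Finset.sum_mul]
  refine neg_le_neg (Finset.sum_le_sum fun i hi => ?_)
  rcases (hp i).eq_or_lt with h | h
  · simp [← h]
  · exact mul_le_mul_of_nonneg_left
      (Real.log_le_log h (Finset.single_le_sum (fun j _ => hp j) hi)) h.le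

/-- Gibbs' inequality: apply `log t ≤ t - 1` to `t = q i * r j / p i j`. The error terms `q i * r j
- p i j` sum to zero because both families have total mass one. -/
lemma sum_negMulLog_le_add {ι κ : Type*} [Fintype ι] [Fintype κ] (p : ι → κ → ℝ)
    (hp : ∀ i j, 0 ≤ p i j) (h1 : ∑ i, ∑ j, p i j = 1) :
    ∑ i, ∑ j, Real.negMulLog (p i j) ≤
      ∑ i, Real.negMulLog (∑ j, p i j) + ∑ j, Real.negMulLog (∑ i, p i j) := by
  set q : ι → ℝ := fun i => ∑ j, p i j with hq
  set r : κ → ℝ := fun j => ∑ i, p i j with hr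
  have hr1 : ∑ j, r j = 1 := by rw [← h1, hr, Finset.sum_comm]
  have key : ∀ i j, Real.negMulLog (p i j) ≤
      -p i j * Real.log (q i) + -p i j * Real.log (r j) + (q i * r j - p i j) := by
    intro i j
    have hqi : p i j ≤ q i := Finset.single_le_sum (fun j _ => hp i j) (Finset.mem_univ j)
    have hrj : p i j ≤ r j :=
      Finset.single_le_sum (f := fun i => p i j) (fun i _ => hp i j) (Finset.mem_univ i)
    rcases (hp i j).eq_or_lt with h | h
    · rw [← h] at hqi hrj ⊢
      simpa using mul_nonneg hqi hrj
    · have hq0 := h.trans_le hqi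
      have hr0 := h.trans_le hrj
      have hlog := Real.log_le_sub_one_of_pos (div_pos (mul_pos hq0 hr0) h)
      rw [Real.log_div (mul_pos hq0 hr0).ne' h.ne', Real.log_mul hq0.ne' hr0.ne'] at hlog
      have := mul_le_mul_of_nonneg_left hlog h.le
      rw [mul_sub (p i j) (q i * r j / p i j), mul_div_cancel₀ _ h.ne'] at this
      rw [Real.negMulLog]
      linarith
  calc ∑ i, ∑ j, Real.negMulLog (p i j)
      ≤ ∑ i, ∑ j, (-p i j * Real.log (q i) + -p i j * Real.log (r j) + (q i * r j - p i j)) :=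
        Finset.sum_le_sum fun i _ => Finset.sum_le_sum fun j _ => key i j
    _ = ∑ i, ∑ j, -p i j * Real.log (q i) + ∑ j, ∑ i, -p i j * Real.log (r j) +
          ((∑ i, q i) * (∑ j, r j) - ∑ i, ∑ j, p i j) := by
        rw [Finset.sum_comm (f := fun j i => -p i j * Real.log (r j)), Finset.sum_mul_sum]
        simp only [Finset.sum_add_distrib, Finset.sum_sub_distrib]
    _ = ∑ i, Real.negMulLog (q i) + ∑ j, Real.negMulLog (r j) := by
        rw [hr1, show ∑ i, ∑ j, p i j = 1 from h1, mul_one, sub_self, add_zero]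
        simp only [← Finset.sum_mul, Finset.sum_neg_distrib, Real.negMulLog, hq, hr]

section Partition

variable (μ : ProbabilityMeasure (FullShift k)) {ι κ : Type} [Fintype ι] [Fintype κ]
  {u : FullShift k → ι} {v : FullShift k → κ}

lemma partitionEntropy_prod :
    partitionEntropy μ (fun x => (u x, v x)) =
      ∑ a, ∑ b, Real.negMulLog ((μ : Measure (FullShift k)).real (u ⁻¹' {a} ∩ v ⁻¹' {b})) := by
  rw [partitionEntropy, Fintype.sum_prod_type]
  refine Finset.sum_congr rfl fun a _ => Finset.sum_congr rfl fun b _ => ?_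
  congr 2
  ext x
  simp

lemma partitionEntropy_nonneg : 0 ≤ partitionEntropy μ u :=
  Finset.sum_nonneg fun _ _ => Real.negMulLog_nonneg measureReal_nonneg measureReal_le_one

lemma partitionEntropy_le_card : partitionEntropy μ u ≤ Fintype.card ι := by
  calc partitionEntropy μ u ≤ ∑ _a : ι, (1 : ℝ) := by
        refine Finset.sum_le_sum fun a _ => ?_
        have h0 : 0 ≤ (μ : Measure (FullShift k)).real (u ⁻¹' {a}) := measureReal_nonneg
        linarith [Real.negMulLog_le_one_sub_self h0]
    _ = Fintype.card ι := by simp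

variable [MeasurableSpace ι] [MeasurableSingletonClass ι]

lemma sum_real_inter_preimage (hu : Measurable u) {s : Set (FullShift k)} :
    ∑ b, (μ : Measure (FullShift k)).real (s ∩ u ⁻¹' {b}) =
      (μ : Measure (FullShift k)).real s := by
  have h := sum_measureReal_preimage_singleton (μ := (μ : Measure (FullShift k)).restrict s)
    (f := u) Finset.univ (fun b _ => hu (measurableSet_singleton b))
  simp only [Finset.coe_univ, Set.preimage_univ, measureReal_restrict_apply_univ] at h
  rw [← h]
  refine Finset.sum_congr rfl fun b _ => ?_
  rw [measureReal_restrict_apply (hu (measurableSet_singleton b)), Set.inter_comm]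

/-- A coarser partition has smaller entropy. -/
lemma partitionEntropy_le_of_refines (hu : Measurable u)
    (h : ∀ x y, u x = u y → v x = v y) : partitionEntropy μ v ≤ partitionEntropy μ u := by
  calc partitionEntropy μ v
      ≤ ∑ b, ∑ a, Real.negMulLog
          ((μ : Measure (FullShift k)).real (v ⁻¹' {b} ∩ u ⁻¹' {a})) := by
        refine Finset.sum_le_sum fun b _ => ?_
        rw [← sum_real_inter_preimage μ hu (s := v ⁻¹' {b})]
        exact negMulLog_sum_le _ _ fun _ => measureReal_nonneg
    _ = ∑ a, ∑ b, Real.negMulLog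
          ((μ : Measure (FullShift k)).real (v ⁻¹' {b} ∩ u ⁻¹' {a})) := Finset.sum_comm
    _ ≤ partitionEntropy μ u := by
        refine Finset.sum_le_sum fun a _ => ?_
        rcases (u ⁻¹' {a}).eq_empty_or_nonempty with he | ⟨x, rfl⟩
        · simp [he]
        · rw [Finset.sum_eq_single (v x)]
          · rw [show v ⁻¹' {v x} ∩ u ⁻¹' {u x} = u ⁻¹' {u x} from
              Set.inter_eq_right.2 fun y hy => h y x hy]
          · intro b _ hb
            rw [show v ⁻¹' {b} ∩ u ⁻¹' {u x} = ∅ from ?_]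
            · simp
            · ext y
              simp only [Set.mem_inter_iff, Set.mem_preimage, Set.mem_singleton_iff,
                Set.mem_empty_iff_false, iff_false, not_and]
              intro hy hy'
              exact hb (hy ▸ h y x hy')
          · simp

variable [MeasurableSpace κ] [MeasurableSingletonClass κ]

lemma partitionEntropy_prod_le (hu : Measurable u) (hv : Measurable v) :
    partitionEntropy μ (fun x => (u x, v x)) ≤ partitionEntropy μ u + partitionEntropy μ v := by
  have hv' : ∀ b, ∑ a, (μ : Measure (FullShift k)).real (u ⁻¹' {a} ∩ v ⁻¹' {b}) =
      (μ : Measure (FullShift k)).real (v ⁻¹' {b}) := fun b => by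
    rw [← sum_real_inter_preimage μ hu (s := v ⁻¹' {b})]
    simp only [Set.inter_comm]
  have h1 : ∑ a, ∑ b, (μ : Measure (FullShift k)).real (u ⁻¹' {a} ∩ v ⁻¹' {b}) = 1 := by
    simp only [sum_real_inter_preimage μ hv]
    have := sum_real_inter_preimage μ hu (s := Set.univ)
    simpa using this
  have := sum_negMulLog_le_add
    (fun a b => (μ : Measure (FullShift k)).real (u ⁻¹' {a} ∩ v ⁻¹' {b}))
    (fun _ _ => measureReal_nonneg) h1
  rw [partitionEntropy_prod]
  simpa only [sum_real_inter_preimage μ hv, hv', partitionEntropy] using this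

end Partition

/-! ### The shift and its itineraries -/

lemma measurable_shift : Measurable (shift (k := k)) :=
  measurable_pi_lambda _ fun n => measurable_pi_apply (n + 1)

lemma continuous_shift : Continuous (shift (k := k)) :=
  continuous_pi fun n => continuous_apply (n + 1)

lemma shift_iterate_apply (i n : ℕ) (x : FullShift k) : shift^[i] x n = x (n + i) := by
  induction i generalizing x with
  | zero => rfl
  | succ i ih => rw [Function.iterate_succ_apply, ih, shift, add_assoc]

variable {m : ℕ} {f g : FullShift k → Fin m}

lemma measurable_itinerary (hf : Measurable f) (n : ℕ) : Measurable (itinerary f n) :=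
  measurable_pi_lambda _ fun i => hf.comp (measurable_shift.iterate i)

lemma itinerary_eq_iff {n : ℕ} {x y : FullShift k} :
    itinerary f n x = itinerary f n y ↔ ∀ i < n, f (shift^[i] x) = f (shift^[i] y) :=
  ⟨fun h i hi => congrFun h ⟨i, hi⟩, fun h => funext fun i => h i i.2⟩

lemma partitionEntropy_comp_iterate {μ : ProbabilityMeasure (FullShift k)} (hμ : IsInvariant μ)
    {ι : Type} [Fintype ι] [MeasurableSpace ι] [MeasurableSingletonClass ι]
    {u : FullShift k → ι} (hu : Measurable u) (n : ℕ) :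
    partitionEntropy μ (fun x => u (shift^[n] x)) = partitionEntropy μ u := by
  refine Finset.sum_congr rfl fun a _ => ?_
  rw [← (MeasurePreserving.iterate hμ n).measureReal_preimage
    (hu (measurableSet_singleton a)).nullMeasurableSet]
  rfl

lemma subadditive_partitionEntropy {μ : ProbabilityMeasure (FullShift k)} (hμ : IsInvariant μ)
    (hf : Measurable f) : Subadditive fun n => partitionEntropy μ (itinerary f n) := by
  intro p q
  have h2 : Measurable fun x => itinerary f q (shift^[p] x) :=
    (measurable_itinerary hf q).comp (measurable_shift.iterate p)
  refine (partitionEntropy_le_of_refines μ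
    (u := fun x => (itinerary f p x, itinerary f q (shift^[p] x)))
    ((measurable_itinerary hf p).prodMk h2) fun x y hxy => ?_).trans
    ((partitionEntropy_prod_le μ (measurable_itinerary hf p) h2).trans_eq ?_)
  · simp only [Prod.mk.injEq, itinerary_eq_iff] at hxy ⊢
    intro i hi
    rcases lt_or_ge i p with h | h
    · exact hxy.1 i h
    · obtain ⟨j, rfl⟩ := Nat.exists_eq_add_of_le' h
      have := hxy.2 j (by omega)
      simpa only [Function.iterate_add_apply] using this
  · rw [partitionEntropy_comp_iterate hμ (measurable_itinerary hf q)]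

/-- The infimum of the normalized entropies of the refinements of a partition. -/
noncomputable def entropyRate (f : FullShift k → Fin m) (μ : ProbabilityMeasure (FullShift k)) :
    ℝ :=
  -- The index starts at one: the quotient at zero has value `0` and would force the infimum to
  -- vanish.
  ⨅ n : ℕ, partitionEntropy μ (itinerary f (n + 1)) / ((n + 1 : ℕ) : ℝ)

lemma bddBelow_entropyRate (f : FullShift k → Fin m) (μ : ProbabilityMeasure (FullShift k)) :
    BddBelow (Set.range fun n : ℕ =>
      partitionEntropy μ (itinerary f (n + 1)) / ((n + 1 : ℕ) : ℝ)) :=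
  ⟨0, by rintro _ ⟨n, rfl⟩; exact div_nonneg (partitionEntropy_nonneg μ) (Nat.cast_nonneg _)⟩

lemma entropyRate_nonneg (f : FullShift k → Fin m) (μ : ProbabilityMeasure (FullShift k)) :
    0 ≤ entropyRate f μ :=
  le_ciInf fun _ => div_nonneg (partitionEntropy_nonneg μ) (Nat.cast_nonneg _)

lemma entropyRate_le_partitionEntropy (hf : Measurable f)
    (μ : ProbabilityMeasure (FullShift k)) : entropyRate f μ ≤ partitionEntropy μ f := by
  refine (ciInf_le (bddBelow_entropyRate f μ) 0).trans ?_
  simp only [zero_add, Nat.cast_one, div_one]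
  refine partitionEntropy_le_of_refines μ hf fun x y hxy => itinerary_eq_iff.2 fun i hi => ?_
  obtain rfl : i = 0 := by omega
  simpa using hxy

lemma tendsto_entropyRate {μ : ProbabilityMeasure (FullShift k)} (hμ : IsInvariant μ)
    (hf : Measurable f) :
    Tendsto (fun n : ℕ => partitionEntropy μ (itinerary f n) / (n : ℝ)) atTop
      (𝓝 (entropyRate f μ)) := by
  have hs := subadditive_partitionEntropy hμ hf
  have hb : BddBelow (Set.range fun n : ℕ => partitionEntropy μ (itinerary f n) / (n : ℝ)) :=
    ⟨0, by rintro _ ⟨n, rfl⟩; exact div_nonneg (partitionEntropy_nonneg μ) (Nat.cast_nonneg _)⟩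
  have ht := hs.tendsto_lim hb
  convert ht using 2
  refine le_antisymm ?_ (le_ciInf fun n => hs.lim_le_div hb n.succ_ne_zero)
  exact ge_of_tendsto' (ht.comp (tendsto_add_atTop_nat 1))
    fun n => ciInf_le (bddBelow_entropyRate f μ) n

lemma entropyOf_eq {μ : ProbabilityMeasure (FullShift k)} (hμ : IsInvariant μ)
    (hf : Measurable f) : entropyOf μ f = (entropyRate f μ : EReal) :=
  ((continuous_coe_real_ereal.tendsto _).comp (tendsto_entropyRate hμ hf)).limsup_eq

/-! ### The generator theorem -/

lemma isLocallyConstant_of_dependsOn_prefix {α : Type*} {u : FullShift k → α} {N : ℕ}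
    (h : ∀ x y : FullShift k, (∀ i < N, x i = y i) → u x = u y) : IsLocallyConstant u := by
  rw [IsLocallyConstant.iff_eventually_eq]
  intro x
  filter_upwards [(PiNat.isOpen_cylinder (fun _ => Fin k) x N).mem_nhds
    (PiNat.self_mem_cylinder x N)] with y hy
  exact h y x hy

/-- Every finite measurable partition is approximated by partitions that depend on finitely many
coordinates. -/
lemma exists_dependsOn_prefix_approx (μ : ProbabilityMeasure (FullShift k)) (hf : Measurable f)
    [NeZero m] {δ : ℝ} (hδ : 0 < δ) :
    ∃ (N : ℕ) (g : FullShift k → Fin m), Measurable g ∧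
      (∀ x y : FullShift k, (∀ i < N, x i = y i) → g x = g y) ∧
      (μ : Measure (FullShift k)).real {x | f x ≠ g x} ≤ δ := by
  have hm : (0 : ℝ) < m := Nat.cast_pos.2 (NeZero.pos m)
  have hdense : (μ : Measure (FullShift k)).MeasureDense (measurableCylinders fun _ : ℕ => Fin k) :=
    Measure.MeasureDense.of_generateFrom_isSetAlgebra_finite _ isSetAlgebra_measurableCylinders
      generateFrom_measurableCylinders.symm
  have hex : ∀ a : Fin m, ∃ (s : Finset ℕ) (C : Set (FullShift k)),
      (∀ x y : FullShift k, (∀ i ∈ s, x i = y i) → (x ∈ C ↔ y ∈ C)) ∧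
      (μ : Measure (FullShift k)).real (symmDiff (f ⁻¹' {a}) C) ≤ δ / m := by
    intro a
    obtain ⟨C, hC, hlt⟩ := hdense.approx _ (hf (measurableSet_singleton a))
      (measure_ne_top _ _) (δ / m) (div_pos hδ hm)
    obtain ⟨s, S, -, rfl⟩ := (mem_measurableCylinders _).1 hC
    refine ⟨s, cylinder s S, fun x y hxy => ?_, ?_⟩
    · rw [mem_cylinder, mem_cylinder, show s.restrict x = s.restrict y from
        funext fun i => hxy i i.2]
    · exact ENNReal.toReal_le_of_le_ofReal (div_pos hδ hm).le hlt.le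
  choose s C hC hsmall using hex
  classical
  -- `G` decodes the set of all `a` with `x ∈ C a`. Off the symmetric differences this set is `{f
  -- x}`, so the value is `f x`; elsewhere any choice will do.
  let G : Set (Fin m) → Fin m := fun t => if h : t.Nonempty then h.choose else 0
  have hG : ∀ a, G {a} = a := fun a => by
    have h : ({a} : Set (Fin m)).Nonempty := ⟨a, rfl⟩
    simp only [G, dif_pos h]
    exact h.choose_spec
  have hdep : ∀ x y : FullShift k, (∀ i < (Finset.univ.biUnion s).sup id + 1, x i = y i) →
      G {a | x ∈ C a} = G {a | y ∈ C a} := by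
    intro x y hxy
    congr 1
    ext a
    refine hC a x y fun i hi => hxy i (Nat.lt_succ_of_le ?_)
    exact Finset.le_sup (f := id) (Finset.mem_biUnion.2 ⟨a, Finset.mem_univ a, hi⟩)
  refine ⟨_, fun x => G {a | x ∈ C a}, ?_, hdep, ?_⟩
  · exact (isLocallyConstant_of_dependsOn_prefix hdep).continuous.measurable
  · have hsub : {x | f x ≠ G {a | x ∈ C a}} ⊆ ⋃ a, symmDiff (f ⁻¹' {a}) (C a) := by
      intro x hx
      by_contra hcon
      simp only [Set.mem_iUnion, not_exists, Set.mem_symmDiff, Set.mem_preimage,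
        Set.mem_singleton_iff] at hcon
      refine hx ?_
      rw [show {a | x ∈ C a} = {f x} from ?_, hG]
      ext a
      have := hcon a
      simp only [Set.mem_ofPred_eq, Set.mem_singleton_iff]
      grind
    calc (μ : Measure (FullShift k)).real {x | f x ≠ G {a | x ∈ C a}}
        ≤ (μ : Measure (FullShift k)).real (⋃ a, symmDiff (f ⁻¹' {a}) (C a)) :=
          measureReal_mono hsub
      _ ≤ ∑ a, (μ : Measure (FullShift k)).real (symmDiff (f ⁻¹' {a}) (C a)) :=
          measureReal_iUnion_fintype_le _
      _ ≤ ∑ _a : Fin m, δ / m := Finset.sum_le_sum fun a _ => hsmall a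
      _ = δ := by simp [field]

/-- A partition with one level set of nearly full measure has small entropy. -/
lemma exists_partitionEntropy_le (m : ℕ) [NeZero m] {ε : ℝ} (hε : 0 < ε) :
    ∃ δ : ℝ, 0 < δ ∧ ∀ (μ : ProbabilityMeasure (FullShift k)) (d : FullShift k → Fin m),
      Measurable d → (μ : Measure (FullShift k)).real {x | d x ≠ 0} ≤ δ →
      partitionEntropy μ d ≤ ε := by
  have hm : (0 : ℝ) < m := Nat.cast_pos.2 (NeZero.pos m)
  have hev : ∀ c : ℝ, Real.negMulLog c = 0 →
      ∃ δ > 0, ∀ t, |t - c| < δ → Real.negMulLog t < ε / m := fun c hc => by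
    have h := Real.continuous_negMulLog.continuousAt (x := c)
    have h2 := h.eventually_lt_const (u := ε / m) (by rw [hc]; positivity)
    obtain ⟨δ, hδ, hh⟩ := Metric.eventually_nhds_iff.1 h2
    exact ⟨δ, hδ, fun t ht => hh (by rwa [Real.dist_eq])⟩
  obtain ⟨δ₀, hδ₀, h₀⟩ := hev 0 Real.negMulLog_zero
  obtain ⟨δ₁, hδ₁, h₁⟩ := hev 1 Real.negMulLog_one
  -- Halving makes the non-strict bound on the measure strict. One cell then has mass near `1` and
  -- all others near `0`, the two zeros of `negMulLog`.
  refine ⟨min δ₀ δ₁ / 2, by positivity, fun μ d hd hμd => ?_⟩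
  have hlt : (μ : Measure (FullShift k)).real {x | d x ≠ 0} < min δ₀ δ₁ :=
    hμd.trans_lt (half_lt_self (lt_min hδ₀ hδ₁))
  calc partitionEntropy μ d ≤ ∑ _a : Fin m, ε / m := by
        refine Finset.sum_le_sum fun a _ => le_of_lt ?_
        by_cases ha : a = 0
        · refine h₁ _ (lt_of_le_of_lt ?_ (hlt.trans_le (min_le_right _ _)))
          have hc : {x | d x ≠ 0} = (d ⁻¹' {a})ᶜ := by ext x; simp [ha]
          rw [hc, probReal_compl_eq_one_sub (hd (measurableSet_singleton a)), abs_sub_comm,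
            abs_of_nonneg (sub_nonneg.2 measureReal_le_one)]
        · refine h₀ _ (lt_of_le_of_lt ?_ (hlt.trans_le (min_le_left _ _)))
          rw [sub_zero, abs_of_nonneg measureReal_nonneg]
          refine measureReal_mono fun x hx => ?_
          simp only [Set.mem_preimage, Set.mem_singleton_iff] at hx
          simpa [hx] using ha
    _ = ε := by simp [field]

/-- The partition of the shift space by the zeroth coordinate. -/
def firstSymbol (x : FullShift k) : Fin k := x 0

lemma measurable_firstSymbol : Measurable (firstSymbol (k := k)) := measurable_pi_apply 0

lemma itinerary_firstSymbol_eq_iff {n : ℕ} {x y : FullShift k} :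
    itinerary firstSymbol n x = itinerary firstSymbol n y ↔ ∀ i < n, x i = y i := by
  simp [itinerary_eq_iff, firstSymbol, shift_iterate_apply]

/-- The first `n + N` symbols determine the `n`-itinerary of `g`. By subadditivity the extra `N`
symbols cost a fixed entropy, which vanishes after division by `n`. -/
lemma entropyRate_le_of_dependsOn_prefix {μ : ProbabilityMeasure (FullShift k)}
    (hμ : IsInvariant μ) (hg : Measurable g) {N : ℕ}
    (h : ∀ x y : FullShift k, (∀ i < N, x i = y i) → g x = g y) :
    entropyRate g μ ≤ entropyRate firstSymbol μ := by
  have h1 := tendsto_entropyRate hμ hg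
  have h2 := (tendsto_entropyRate hμ (measurable_firstSymbol (k := k))).add
    (tendsto_const_div_atTop_nhds_zero_nat
      (partitionEntropy μ (itinerary (firstSymbol (k := k)) N)))
  rw [add_zero] at h2
  refine le_of_tendsto_of_tendsto' h1 h2 fun n => ?_
  rw [← add_div]
  gcongr
  refine (partitionEntropy_le_of_refines μ (measurable_itinerary measurable_firstSymbol (n + N))
    fun x y hxy => ?_).trans (subadditive_partitionEntropy hμ measurable_firstSymbol n N)
  rw [itinerary_firstSymbol_eq_iff] at hxy
  refine itinerary_eq_iff.2 fun i hi => h _ _ fun j hj => ?_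
  rw [shift_iterate_apply, shift_iterate_apply]
  exact hxy _ (by omega)

/-- The difference, taken in the cyclic group `Fin m`, serves as a correction: together with `g` it
recovers `f`, and it is `0` exactly where `f` and `g` agree. It therefore has small entropy when `g`
approximates `f`. -/
lemma entropyRate_le_add_sub {μ : ProbabilityMeasure (FullShift k)} (hμ : IsInvariant μ)
    [NeZero m] (hf : Measurable f) (hg : Measurable g) :
    entropyRate f μ ≤ entropyRate g μ + entropyRate (fun x => f x - g x) μ := by
  have hd : Measurable fun x => f x - g x :=
    (measurable_of_finite fun p : Fin m × Fin m => p.1 - p.2).comp (hf.prodMk hg)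
  refine le_of_tendsto_of_tendsto' (tendsto_entropyRate hμ hf)
    ((tendsto_entropyRate hμ hg).add (tendsto_entropyRate hμ hd)) fun n => ?_
  rw [← add_div]
  gcongr
  have hg' := measurable_itinerary hg n
  have hd' := measurable_itinerary hd n
  refine (partitionEntropy_le_of_refines μ (hg'.prodMk hd') fun x y hxy => ?_).trans
    (partitionEntropy_prod_le μ hg' hd')
  simp only [Prod.mk.injEq, itinerary_eq_iff] at hxy ⊢
  intro i hi
  have h1 := hxy.1 i hi
  have h2 := hxy.2 i hi
  rw [h1] at h2
  exact sub_left_injective h2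

lemma entropyRate_le_firstSymbol [NeZero k] {μ : ProbabilityMeasure (FullShift k)}
    (hμ : IsInvariant μ) (hf : Measurable f) : entropyRate f μ ≤ entropyRate firstSymbol μ := by
  have : NeZero m := ⟨by rintro rfl; exact (f fun _ => 0).elim0⟩
  refine le_of_forall_pos_le_add fun ε hε => ?_
  obtain ⟨δ, hδ, hsmall⟩ := exists_partitionEntropy_le (k := k) m hε
  obtain ⟨N, g, hg, hdep, hfg⟩ := exists_dependsOn_prefix_approx μ hf hδ
  have hd : Measurable fun x => f x - g x :=
    (measurable_of_finite fun p : Fin m × Fin m => p.1 - p.2).comp (hf.prodMk hg)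
  refine (entropyRate_le_add_sub hμ hf hg).trans
    (add_le_add (entropyRate_le_of_dependsOn_prefix hμ hg hdep) ?_)
  refine (entropyRate_le_partitionEntropy hd μ).trans (hsmall μ _ hd ?_)
  simpa only [ne_eq, sub_eq_zero] using hfg

/-- The partition by the zeroth coordinate generates: it carries the whole entropy. -/
theorem entropy_eq_entropyRate [NeZero k] {μ : ProbabilityMeasure (FullShift k)}
    (hμ : IsInvariant μ) : entropy μ = (entropyRate firstSymbol μ : EReal) := by
  refine le_antisymm (iSup_le fun m => iSup_le fun f => iSup_le fun hf => ?_) ?_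
  · rw [entropyOf_eq hμ hf]
    exact EReal.coe_le_coe_iff.2 (entropyRate_le_firstSymbol hμ hf)
  · rw [← entropyOf_eq hμ measurable_firstSymbol]
    exact le_iSup_of_le k (le_iSup_of_le firstSymbol (le_iSup_of_le measurable_firstSymbol le_rfl))

/-! ### Weak-* topology: invariant measures, integrals and entropy -/

lemma continuous_of_isHolder {α : ℝ} (hα : 0 < α) {A : FullShift k → ℝ} (hA : IsHolder α A) :
    Continuous A := by
  obtain ⟨C, hC⟩ := hA
  rw [continuous_iff_continuousAt]
  intro x
  refine tendsto_iff_dist_tendsto_zero.2 ?_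
  have hd : Tendsto (fun y => seqDist y x) (𝓝 x) (𝓝 0) := by
    rw [Metric.tendsto_nhds]
    intro ε hε
    obtain ⟨n, hn⟩ := exists_pow_lt_of_lt_one hε (one_half_lt_one (α := ℝ))
    filter_upwards [(PiNat.isOpen_cylinder (fun _ => Fin k) x n).mem_nhds
      (PiNat.self_mem_cylinder x n)] with y hy
    have h0 : 0 ≤ seqDist y x := PiNat.dist_nonneg y x
    rw [Real.dist_eq, sub_zero, abs_of_nonneg h0]
    exact (PiNat.mem_cylinder_iff_dist_le.1 hy).trans_lt hn
  have hr : Tendsto (fun y => C * seqDist y x ^ α) (𝓝 x) (𝓝 0) := by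
    have := (hd.rpow_const (p := α) (Or.inr hα.le)).const_mul C
    rwa [Real.zero_rpow hα.ne', mul_zero] at this
  exact squeeze_zero (fun _ => dist_nonneg) (fun y => hC y x) hr

lemma isInvariant_iff_map_eq {μ : ProbabilityMeasure (FullShift k)} :
    IsInvariant μ ↔ μ.map continuous_shift.measurable.aemeasurable = μ := by
  exact ⟨fun h => Subtype.ext h.map_eq, fun h => ⟨measurable_shift, congrArg Subtype.val h⟩⟩

lemma isClosed_setOf_isInvariant :
    IsClosed {μ : ProbabilityMeasure (FullShift k) | IsInvariant μ} := by
  simp only [isInvariant_iff_map_eq]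
  exact isClosed_eq (ProbabilityMeasure.continuous_map continuous_shift) continuous_id

lemma exists_isInvariant [NeZero k] : ∃ μ : ProbabilityMeasure (FullShift k), IsInvariant μ := by
  refine ⟨⟨Measure.dirac fun _ => 0, inferInstance⟩, measurable_shift, ?_⟩
  exact Measure.map_dirac' measurable_shift _

lemma continuous_integral {A : FullShift k → ℝ} (hA : Continuous A) :
    Continuous fun μ : ProbabilityMeasure (FullShift k) =>
      ∫ x, A x ∂(μ : Measure (FullShift k)) := by
  rw [continuous_iff_continuousAt]
  exact fun μ => ProbabilityMeasure.tendsto_iff_forall_integral_tendsto.1 tendsto_id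
    (BoundedContinuousFunction.mkOfCompact ⟨A, hA⟩)

lemma continuous_partitionEntropy_firstSymbol (n : ℕ) :
    Continuous fun μ : ProbabilityMeasure (FullShift k) =>
      partitionEntropy μ (itinerary firstSymbol n) := by
  refine continuous_finsetSum _ fun a _ => Real.continuous_negMulLog.comp ?_
  have hclopen : IsClopen (itinerary (firstSymbol (k := k)) n ⁻¹' {a}) :=
    (isLocallyConstant_of_dependsOn_prefix
      fun x y h => itinerary_firstSymbol_eq_iff.2 h).isClopen_fiber a
  rw [continuous_iff_continuousAt]
  exact fun μ => (NNReal.continuous_coe.tendsto _).comp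
    (ProbabilityMeasure.tendsto_measure_of_isClopen_of_tendsto tendsto_id hclopen)

/-- The entropy of the full shift is upper semicontinuous. -/
lemma upperSemicontinuous_entropyRate :
    UpperSemicontinuous fun μ : ProbabilityMeasure (FullShift k) => entropyRate firstSymbol μ :=
  -- This is where the form of `entropyRate` as an infimum, rather than a limit, matters.
  upperSemicontinuous_ciInf (fun μ => bddBelow_entropyRate _ μ) fun n =>
    ((continuous_partitionEntropy_firstSymbol (n + 1)).div_const _).upperSemicontinuous

/-- Cruder than `log k`, but only a bound uniform in `μ` is needed. -/
lemma entropyRate_firstSymbol_le (μ : ProbabilityMeasure (FullShift k)) :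
    entropyRate firstSymbol μ ≤ k :=
  (entropyRate_le_partitionEntropy measurable_firstSymbol μ).trans
    ((partitionEntropy_le_card μ).trans_eq (by simp))

/-! ### Maximizing measures -/

section Maximizing

variable {A : FullShift k → ℝ}

lemma isGreatest_invariantIntegrals [NeZero k] (hA : Continuous A) :
    IsGreatest (invariantIntegrals A) (maxIntegral A) := by
  have h : invariantIntegrals A =
      (fun μ : ProbabilityMeasure (FullShift k) => ∫ x, A x ∂(μ : Measure (FullShift k))) ''
        {μ | IsInvariant μ} := by
    ext t
    exact ⟨fun ⟨ν, h1, h2⟩ => ⟨ν, h1, h2.symm⟩, fun ⟨ν, h1, h2⟩ => ⟨ν, h1, h2.symm⟩⟩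
  rw [maxIntegral, h]
  exact (isClosed_setOf_isInvariant.isCompact.image (continuous_integral hA)).isGreatest_sSup
    (Set.Nonempty.image _ exists_isInvariant)

lemma integral_le_maxIntegral [NeZero k] (hA : Continuous A)
    {μ : ProbabilityMeasure (FullShift k)} (hμ : IsInvariant μ) :
    ∫ x, A x ∂(μ : Measure (FullShift k)) ≤ maxIntegral A :=
  (isGreatest_invariantIntegrals hA).2 ⟨μ, hμ, rfl⟩

lemma isMaximizing_iff [NeZero k] (hA : Continuous A) {μ : ProbabilityMeasure (FullShift k)} :
    IsMaximizing A μ ↔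
      IsInvariant μ ∧ maxIntegral A ≤ ∫ x, A x ∂(μ : Measure (FullShift k)) := by
  refine and_congr_right fun hμ => ⟨fun h => h.2 (isGreatest_invariantIntegrals hA).1, fun h => ?_⟩
  rw [(integral_le_maxIntegral hA hμ).antisymm h]
  exact isGreatest_invariantIntegrals hA

lemma isCompact_setOf_isMaximizing [NeZero k] (hA : Continuous A) :
    IsCompact {μ | IsMaximizing A μ} := by
  simp only [isMaximizing_iff hA]
  exact (isClosed_setOf_isInvariant.inter
    (isClosed_le continuous_const (continuous_integral hA))).isCompact

lemma exists_isMaximizing_forall_entropyRate_le [NeZero k] (hA : Continuous A) :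
    ∃ ν, IsMaximizing A ν ∧
      ∀ μ, IsMaximizing A μ → entropyRate firstSymbol μ ≤ entropyRate firstSymbol ν := by
  have hne : {μ | IsMaximizing A μ}.Nonempty := by
    obtain ⟨μ, hμ, h⟩ := (isGreatest_invariantIntegrals hA).1
    exact ⟨μ, (isMaximizing_iff hA).2 ⟨hμ, h.le⟩⟩
  exact UpperSemicontinuousOn.exists_isMaxOn hne (isCompact_setOf_isMaximizing hA)
    (upperSemicontinuous_entropyRate.upperSemicontinuousOn _)

/-- Invariant measures whose integral is almost maximal have entropy at most slightly larger than
the maximizing measures. -/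
lemma exists_forall_entropyRate_lt [NeZero k] (hA : Continuous A) {c : ℝ}
    (hc : ∀ μ, IsMaximizing A μ → entropyRate firstSymbol μ < c) :
    ∃ δ > 0, ∀ μ : ProbabilityMeasure (FullShift k), IsInvariant μ →
      maxIntegral A - δ ≤ ∫ x, A x ∂(μ : Measure (FullShift k)) →
      entropyRate firstSymbol μ < c := by
  have hK : IsCompact {μ : ProbabilityMeasure (FullShift k) |
      IsInvariant μ ∧ c ≤ entropyRate firstSymbol μ} :=
    (isClosed_setOf_isInvariant.inter
      (upperSemicontinuous_entropyRate.isClosed_preimage c)).isCompact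
  rcases Set.eq_empty_or_nonempty {μ : ProbabilityMeasure (FullShift k) |
      IsInvariant μ ∧ c ≤ entropyRate firstSymbol μ} with he | hne
  · refine ⟨1, one_pos, fun μ hμ _ => lt_of_not_ge fun h => ?_⟩
    exact Set.eq_empty_iff_forall_notMem.1 he μ ⟨hμ, h⟩
  · obtain ⟨ν, hν, hmax⟩ := hK.exists_isMaxOn hne (continuous_integral hA).continuousOn
    have hlt : ∫ x, A x ∂(ν : Measure (FullShift k)) < maxIntegral A := lt_of_not_ge fun h =>
      (hc ν ((isMaximizing_iff hA).2 ⟨hν.1, h⟩)).not_ge hν.2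
    -- Half the gap between `maxIntegral A` and the best integral attained with entropy at least
    -- `c`.
    refine ⟨(maxIntegral A - ∫ x, A x ∂(ν : Measure (FullShift k))) / 2, by linarith,
      fun μ hμ h => lt_of_not_ge fun h' => ?_⟩
    have := isMaxOn_iff.1 hmax μ ⟨hμ, h'⟩
    linarith

end Maximizing

/-! ### Pressure and its asymptote -/

section Pressure

variable {A : FullShift k → ℝ}

lemma entropy_add_integral [NeZero k] {μ : ProbabilityMeasure (FullShift k)} (hμ : IsInvariant μ)
    (β : ℝ) : entropy μ + ((∫ x, β * A x ∂(μ : Measure (FullShift k)) : ℝ) : EReal) =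
      ((entropyRate firstSymbol μ + β * ∫ x, A x ∂(μ : Measure (FullShift k)) : ℝ) : EReal) := by
  rw [entropy_eq_entropyRate hμ, integral_const_mul, EReal.coe_add]

lemma le_pressure [NeZero k] {μ : ProbabilityMeasure (FullShift k)} (hμ : IsInvariant μ)
    (β : ℝ) :
    ((entropyRate firstSymbol μ + β * ∫ x, A x ∂(μ : Measure (FullShift k)) : ℝ) : EReal) ≤
      pressure fun x => β * A x := by
  rw [← entropy_add_integral hμ]
  exact le_iSup₂_of_le (f := fun (μ : ProbabilityMeasure (FullShift k)) (_ : IsInvariant μ) =>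
    entropy μ + ((∫ x, β * A x ∂(μ : Measure (FullShift k)) : ℝ) : EReal)) μ hμ le_rfl

lemma pressure_le [NeZero k] {β c : ℝ} (h : ∀ μ : ProbabilityMeasure (FullShift k),
      IsInvariant μ →
      entropyRate firstSymbol μ + β * ∫ x, A x ∂(μ : Measure (FullShift k)) ≤ c) :
    pressure (fun x => β * A x) ≤ (c : EReal) :=
  iSup₂_le fun μ hμ => by
    rw [entropy_add_integral hμ]
    exact EReal.coe_le_coe_iff.2 (h μ hμ)

variable [NeZero k] {ν : ProbabilityMeasure (FullShift k)}

lemma eventually_pressure_le (hA : Continuous A) {h : ℝ}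
    (hmax : ∀ μ, IsMaximizing A μ → entropyRate firstSymbol μ ≤ h)
    (h0 : 0 ≤ h) {ε : ℝ} (hε : 0 < ε) :
    ∀ᶠ β : ℝ in atTop,
      pressure (fun x => β * A x) ≤ ((h + β * maxIntegral A + ε : ℝ) : EReal) := by
  obtain ⟨δ, hδ, hlt⟩ := exists_forall_entropyRate_lt hA (c := h + ε)
    fun μ hμ => (hmax μ hμ).trans_lt (lt_add_of_pos_right _ hε)
  filter_upwards [eventually_ge_atTop (k / δ), eventually_ge_atTop 0] with β hβ hβ0
  refine pressure_le fun μ hμ => ?_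
  -- Near the maximum, entropy is below `h + ε`. Otherwise the integral term loses at least `β * δ ≥
  -- k`, which outweighs the entropy.
  rcases le_or_gt (maxIntegral A - δ) (∫ x, A x ∂(μ : Measure (FullShift k))) with hle | hgt
  · linarith [hlt μ hμ hle, mul_le_mul_of_nonneg_left (integral_le_maxIntegral hA hμ) hβ0]
  · rw [div_le_iff₀ hδ] at hβ
    linarith [entropyRate_firstSymbol_le μ, mul_le_mul_of_nonneg_left hgt.le hβ0]

lemma tendsto_pressure_sub (hA : Continuous A) (hν : IsMaximizing A ν)
    (hmax : ∀ μ, IsMaximizing A μ → entropyRate firstSymbol μ ≤ entropyRate firstSymbol ν) :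
    Tendsto (fun β : ℝ => pressure (fun x => β * A x) -
      ((entropyRate firstSymbol ν + β * maxIntegral A : ℝ) : EReal)) atTop (𝓝 0) := by
  have hint : ∫ x, A x ∂(ν : Measure (FullShift k)) = maxIntegral A :=
    hν.2.unique (isGreatest_invariantIntegrals hA)
  have hlow (β : ℝ) := le_pressure (A := A) hν.1 β
  rw [hint] at hlow
  have hge (β : ℝ) : 0 ≤ pressure (fun x => β * A x) -
      ((entropyRate firstSymbol ν + β * maxIntegral A : ℝ) : EReal) := by
    refine (EReal.sub_nonneg (.inr (EReal.coe_ne_top _)) (.inr (EReal.coe_ne_bot _))).2 (hlow β)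
  refine tendsto_order.2 ⟨fun a ha => .of_forall fun β => ha.trans_le (hge β), fun a ha => ?_⟩
  obtain ⟨ε, hε, hεa⟩ := EReal.lt_iff_exists_real_btwn.1 ha
  filter_upwards [eventually_pressure_le hA hmax (entropyRate_nonneg _ ν)
    (EReal.coe_pos.1 hε)] with β hβ
  refine lt_of_le_of_lt (EReal.sub_le_of_le_add' ?_) hεa
  rwa [← EReal.coe_add]

/-- Testing equilibrium against `ν` gives `hineq`. With entropy at most `k`, it puts the integral of
`μβ β` within `k / β` of the maximum; with that integral at most `maxIntegral A`, it gives `μβ β` at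
least the entropy of `ν` for every `β > 0`. Both are closed conditions, so they pass to cluster
points. -/
lemma IsGroundState.isMaximizing_and_le (hA : Continuous A) (hν : IsMaximizing A ν)
    {μ : ProbabilityMeasure (FullShift k)} (hμ : IsGroundState A μ) :
    IsMaximizing A μ ∧ entropyRate firstSymbol ν ≤ entropyRate firstSymbol μ := by
  obtain ⟨μβ, heq, hcl⟩ := hμ
  have hint : ∫ x, A x ∂(ν : Measure (FullShift k)) = maxIntegral A :=
    hν.2.unique (isGreatest_invariantIntegrals hA)
  have hineq : ∀ β : ℝ, 0 < β → entropyRate firstSymbol ν + β * maxIntegral A ≤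
      entropyRate firstSymbol (μβ β) + β * ∫ x, A x ∂(μβ β : Measure (FullShift k)) := by
    intro β hβ
    have h1 := le_pressure (A := A) hν.1 β
    rw [← (heq β hβ).2, entropy_add_integral (heq β hβ).1, hint] at h1
    exact EReal.coe_le_coe_iff.1 h1
  have hpos := eventually_gt_atTop (0 : ℝ)
  have hinv : IsInvariant μ := isClosed_setOf_isInvariant.mem_of_mapClusterPt hcl
    (hpos.mono fun β hβ => (heq β hβ).1)
  refine ⟨(isMaximizing_iff hA).2 ⟨hinv, le_of_forall_pos_sub_le fun δ hδ => ?_⟩, ?_⟩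
  · have hcl' : IsClosed {μ : ProbabilityMeasure (FullShift k) |
        maxIntegral A - δ ≤ ∫ x, A x ∂(μ : Measure (FullShift k))} :=
      isClosed_le continuous_const (continuous_integral hA)
    refine hcl'.mem_of_mapClusterPt hcl ?_
    filter_upwards [hpos, eventually_ge_atTop (k / δ)] with β hβ hβk
    rw [div_le_iff₀ hδ] at hβk
    refine le_of_mul_le_mul_left (a := β) ?_ hβ
    linarith [hineq β hβ, entropyRate_firstSymbol_le (μβ β), entropyRate_nonneg firstSymbol ν]
  · have hcl' : IsClosed {μ : ProbabilityMeasure (FullShift k) |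
        entropyRate firstSymbol ν ≤ entropyRate firstSymbol μ} :=
      upperSemicontinuous_entropyRate.isClosed_preimage _
    refine hcl'.mem_of_mapClusterPt hcl (hpos.mono fun β hβ => ?_)
    show entropyRate firstSymbol ν ≤ entropyRate firstSymbol (μβ β)
    linarith [hineq β hβ,
      mul_le_mul_of_nonneg_left (integral_le_maxIntegral hA (heq β hβ).1) hβ.le]

end Pressure

end ErgOpt

theorem mainTheorem4 (k : ℕ) (hk : 1 ≤ k) (α : ℝ) (hα0 : 0 < α) (hα1 : α ≤ 1)
    (A : ErgOpt.FullShift k → ℝ) (hA : ErgOpt.IsHolder α A) :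
    ∃ hmax : ℝ,
      IsGreatest (ErgOpt.entropy '' {ν | ErgOpt.IsMaximizing A ν}) (hmax : EReal) ∧
      (∀ μ : ProbabilityMeasure (ErgOpt.FullShift k), ErgOpt.IsGroundState A μ →
        ErgOpt.IsMaximizing A μ ∧ ErgOpt.entropy μ = (hmax : EReal)) ∧
      Tendsto (fun β : ℝ => ErgOpt.pressure (fun x => β * A x) -
          ((hmax + β * ErgOpt.maxIntegral A : ℝ) : EReal)) atTop (𝓝 0) := by
  have : NeZero k := ⟨by omega⟩
  have hc := ErgOpt.continuous_of_isHolder hα0 hA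
  obtain ⟨ν, hν, hmax⟩ := ErgOpt.exists_isMaximizing_forall_entropyRate_le hc
  refine ⟨ErgOpt.entropyRate ErgOpt.firstSymbol ν,
    ⟨⟨ν, hν, ErgOpt.entropy_eq_entropyRate hν.1⟩, ?_⟩, fun μ hμ => ?_,
    ErgOpt.tendsto_pressure_sub hc hν hmax⟩
  · rintro _ ⟨μ, hμ, rfl⟩
    rw [ErgOpt.entropy_eq_entropyRate hμ.1]
    exact EReal.coe_le_coe_iff.2 (hmax μ hμ)
  · obtain ⟨h1, h2⟩ := hμ.isMaximizing_and_le hc hν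
    exact ⟨h1, by rw [ErgOpt.entropy_eq_entropyRate h1.1, (hmax μ h1).antisymm h2]⟩
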